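/- **Theorem 3.7.** Let $G$ be an arbitrary (discrete) group. A *semicharacter* on $G$ is a function $f:G\to[1,\infty)$ with $f(st)\le f(s)f(t)$ for all $s,t\in G$; let $\mathrm{SC}(G)$ be the set of all semicharacters. Let $\mathcal O_\flat(G)$ be the space of all $\alpha:G\to\mathbb C$ such that $\|\alpha\|_f:=\sum_{t\in G}|\alpha(t)|f(t)<\infty$ for every $f\in\mathrm{SC}(G)$, with the locally convex topology generated by the seminorms $\|\cdot\|_f$, $f\in \mathrm{SC}(G)$. Let $\mathcal O_\flat(G)^\star$ be the space of all continuous linear functionals on $\mathcal O_\flat(G)$ with the topology of uniform convergence on totally bounded sets. For $f\in\mathrm{SC}(G)$ let $f^\blacksquare=\{u:G\to\mathbb C:\ |u(t)|\le f(t)\ \forall t\in G\}$ with the topology of pointwise convergence, and let $\mathcal O_f(G)=\bigcup_{\lambda\in\mathbb C}\lambda f^\blacksquare$ be the Smith space with universal compact set $f^\blacksquare$, i.e. a set $M\subseteq\mathcal O_f(G)$ is closed if and only if $M\cap\lambda f^\blacksquare$ is closed in $\lambda f^\blacksquare$ for the pointwise topology, for every $\lambda\in\mathbb C$. Let $\mathcal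 O_\sharp(G)=\bigcup_{f\in\mathrm{SC}(G)}\mathcal O_f(G)$ be the injective limit of the spaces $\mathcal O_f(G)$ in the category of locally convex spaces, i.e. it carries the finest locally convex topology for which all inclusions $\mathcal O_f(G)\to\mathcal O_\sharp(G)$ are continuous. Then for all $u\in\mathcal O_\sharp(G)$ and $\alpha\in\mathcal O_\flat(G)$ the series $$h_u(\alpha)=\sum_{t\in G}\alpha(t)\,u(t)$$ converges unconditionally, and $u\mapsto h_u$ is an isomorphism of locally convex spaces (a linear bijection that is a homeomorphism) $$\mathcal O_\sharp(G)\;\cong\;\mathcal O_\flat(G)^\star .$$ -/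

import Mathlib

noncomputable section

/-- A semicharacter on a group `G`: a function `f : G → [1, ∞)` with `f (s t) ≤ f s * f t`. -/
structure Semicharacter (G : Type*) [Group G] where
  toFun : G → ℝ
  one_le : ∀ t, 1 ≤ toFun t
  map_mul_le : ∀ s t, toFun (s * t) ≤ toFun s * toFun t

namespace Semicharacter

variable {G : Type*} [Group G]

instance : CoeFun (Semicharacter G) (fun _ => G → ℝ) := ⟨toFun⟩

theorem nonneg (f : Semicharacter G) (t : G) : 0 ≤ f t :=
  zero_le_one.trans (f.one_le t)

/-- The semicharacter identically equal to `1`. -/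
def one : Semicharacter G where
  toFun _ := 1
  one_le _ := le_rfl
  map_mul_le _ _ := by norm_num

instance : Nonempty (Semicharacter G) := ⟨one⟩

/-- The pointwise sum of two semicharacters is a semicharacter. -/
def add (f g : Semicharacter G) : Semicharacter G where
  toFun t := f t + g t
  one_le t := by linarith [f.one_le t, g.nonneg t]
  map_mul_le s t := by
    nlinarith [f.map_mul_le s t, g.map_mul_le s t, mul_nonneg (f.nonneg s) (g.nonneg t),
      mul_nonneg (g.nonneg s) (f.nonneg t)]

end Semicharacter

section SmithSpace

variable {G : Type*} [Group G]

/-- The rectangle generated by a semicharacter `f`: all `u : G → ℂ` with `|u t| ≤ f t`.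
As a subset of `G → ℂ` it carries the topology of pointwise convergence. -/
def rectangle (f : Semicharacter G) : Set (G → ℂ) :=
  {u | ∀ t, ‖u t‖ ≤ f t}

/-- The vector space of the functions `u : G → ℂ` majorized by `f` up to a constant. -/
def smithSubmodule (f : Semicharacter G) : Submodule ℂ (G → ℂ) where
  carrier := {u | ∃ C : ℝ, 0 < C ∧ ∀ t, ‖u t‖ ≤ C * f t}
  zero_mem' := ⟨1, one_pos, fun t => by simpa using f.nonneg t⟩
  add_mem' := by
    rintro u v ⟨C, hC, hu⟩ ⟨D, hD, hv⟩
    refine ⟨C + D, add_pos hC hD, fun t => ?_⟩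
    calc ‖(u + v) t‖ ≤ ‖u t‖ + ‖v t‖ := norm_add_le _ _
      _ ≤ (C + D) * f t := by rw [add_mul]; exact add_le_add (hu t) (hv t)
  smul_mem' := by
    rintro c u ⟨C, hC, hu⟩
    refine ⟨(‖c‖ + 1) * C, by positivity, fun t => ?_⟩
    calc ‖(c • u) t‖ = ‖c‖ * ‖u t‖ := by simp
      _ ≤ (‖c‖ + 1) * (C * f t) :=
        mul_le_mul (by linarith) (hu t) (norm_nonneg _) (by positivity)
      _ = (‖c‖ + 1) * C * f t := by ring

theorem smul_mem_smithSubmodule (f : Semicharacter G) (c : ℂ) {u : G → ℂ}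
    (hu : u ∈ rectangle f) : c • u ∈ smithSubmodule f :=
  (smithSubmodule f).smul_mem c ⟨1, one_pos, fun t => by simpa using hu t⟩

/-- The space `O_f(G)`. It is a type synonym of the submodule, because it does not carry the
topology of pointwise convergence (see the next instance). -/
def OSmith (f : Semicharacter G) : Type _ := smithSubmodule f

instance (f : Semicharacter G) : AddCommGroup (OSmith f) :=
  inferInstanceAs (AddCommGroup (smithSubmodule f))

instance (f : Semicharacter G) : Module ℂ (OSmith f) :=
  inferInstanceAs (Module ℂ (smithSubmodule f))

/-- The map `u ↦ c • u` from `rectangle f` to `O_f(G)`. -/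
def OSmith.dilation (f : Semicharacter G) (c : ℂ) (u : rectangle f) : OSmith f :=
  (⟨c • u.1, smul_mem_smithSubmodule f c u.2⟩ : smithSubmodule f)

/-- The topology of the Smith space `O_f(G) = ⋃ λ • rectangle f` with the universal compact set
`rectangle f`. A Smith space is a complete locally convex `k`-space with a universal compact set
(one that absorbs every compact set), so its topology is determined by that set: a subset is closed
if and only if its intersection with each homothety `λ • rectangle f`, `λ ∈ ℂ`, is closed
for the pointwise topology of `λ • rectangle f`; equivalently its preimage under each map
`u ↦ λ • u` from `rectangle f` is closed. -/
instance (f : Semicharacter G) : TopologicalSpace (OSmith f) :=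
  ⨆ c : ℂ, TopologicalSpace.coinduced (OSmith.dilation f c) inferInstance

end SmithSpace

section Sharp

variable (G : Type*) [Group G]

/-- The union of the vector spaces `O_f(G)` over all semicharacters `f`. The system is
directed (`f, g ≤ f + g`), with injective connecting maps, so this union is its
injective limit as a vector space. -/
def sharpSubmodule : Submodule ℂ (G → ℂ) where
  carrier := {u | ∃ f : Semicharacter G, u ∈ smithSubmodule f}
  zero_mem' := ⟨Semicharacter.one, Submodule.zero_mem _⟩
  add_mem' := by
    rintro u v ⟨f, C, hC, hu⟩ ⟨g, D, hD, hv⟩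
    refine ⟨f.add g, C + D, add_pos hC hD, fun t => ?_⟩
    have h1 := f.nonneg t
    have h2 := g.nonneg t
    calc ‖(u + v) t‖ ≤ ‖u t‖ + ‖v t‖ := norm_add_le _ _
      _ ≤ C * f t + D * g t := add_le_add (hu t) (hv t)
      _ ≤ (C + D) * (f t + g t) := by
        nlinarith [mul_nonneg hC.le h2, mul_nonneg hD.le h1]
  smul_mem' := by
    rintro c u ⟨f, hu⟩
    exact ⟨f, Submodule.smul_mem _ c hu⟩

/-- The space `O_♯(G)`, a type synonym of the union of the spaces `O_f(G)`. -/
def OSharp : Type _ := sharpSubmodule G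

instance : AddCommGroup (OSharp G) := inferInstanceAs (AddCommGroup (sharpSubmodule G))

instance : Module ℂ (OSharp G) := inferInstanceAs (Module ℂ (sharpSubmodule G))

instance : CoeFun (OSharp G) (fun _ => G → ℂ) :=
  ⟨fun u => (Subtype.val (u : sharpSubmodule G) : G → ℂ)⟩

variable {G} in
/-- The inclusion of `O_f(G)` into `O_♯(G)`. -/
def OSharp.incl (f : Semicharacter G) : OSmith f →ₗ[ℂ] OSharp G :=
  Submodule.inclusion (p := smithSubmodule f) (p' := sharpSubmodule G) (fun _ hu => ⟨f, hu⟩)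

/-- The locally convex vector space topologies on `O_♯(G)` for which all the inclusions
`O_f(G) → O_♯(G)` are continuous. -/
def OSharp.admissible : Set (TopologicalSpace (OSharp G)) :=
  {τ | @IsTopologicalAddGroup (OSharp G) τ _ ∧
    @ContinuousSMul ℂ (OSharp G) _ _ τ ∧
    @LocallyConvexSpace ℝ (OSharp G) _ _ _ _ τ ∧
    ∀ f : Semicharacter G, @Continuous (OSmith f) (OSharp G) _ τ (OSharp.incl f)}

/-- The topology of the injective limit in the category of locally convex spaces: the finest
locally convex vector space topology for which all the inclusions of the `O_f(G)` are continuous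
(in Mathlib's order on topologies, finer is smaller). -/
instance : TopologicalSpace (OSharp G) := sInf (OSharp.admissible G)

instance : IsTopologicalAddGroup (OSharp G) := topologicalAddGroup_sInf fun _ h => h.1

instance : ContinuousSMul ℂ (OSharp G) := continuousSMul_sInf fun _ h => h.2.1

instance : LocallyConvexSpace ℝ (OSharp G) := LocallyConvexSpace.sInf fun _ h => h.2.2.1

theorem OSharp.continuous_incl (f : Semicharacter G) :
    Continuous (OSharp.incl (G := G) f) :=
  continuous_sInf_rng.2 fun _ h => h.2.2.2 f

end Sharp

section Flat

variable (G : Type*) [Group G]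

/-- The vector space of the functions `α : G → ℂ` such that `∑ t, |α t| * f t` converges
for every semicharacter `f`. -/
def flatSubmodule : Submodule ℂ (G → ℂ) where
  carrier := {α | ∀ f : Semicharacter G, Summable fun t => ‖α t‖ * f t}
  zero_mem' f := by simp
  add_mem' := by
    intro α β hα hβ f
    refine Summable.of_nonneg_of_le (fun t => mul_nonneg (norm_nonneg _) (f.nonneg t))
      (fun t => ?_) ((hα f).add (hβ f))
    rw [← add_mul]
    exact mul_le_mul_of_nonneg_right (norm_add_le _ _) (f.nonneg t)
  smul_mem' := by
    intro c α hα f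
    simpa [mul_assoc] using (hα f).mul_left ‖c‖

/-- The space `O_b(G)`, a type synonym of the submodule, because its topology is generated by
the seminorms below. -/
def OFlat : Type _ := flatSubmodule G

instance : AddCommGroup (OFlat G) := inferInstanceAs (AddCommGroup (flatSubmodule G))

instance : Module ℂ (OFlat G) := inferInstanceAs (Module ℂ (flatSubmodule G))

instance : CoeFun (OFlat G) (fun _ => G → ℂ) :=
  ⟨fun α => (Subtype.val (α : flatSubmodule G) : G → ℂ)⟩

/-- The seminorms `‖α‖_f = ∑ t, |α t| * f t` on `O_b(G)`. -/
def OFlat.seminorms : SeminormFamily ℂ (OFlat G) (Semicharacter G) := fun f =>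
  Seminorm.of (fun α : OFlat G => ∑' t, ‖α t‖ * f t)
    (fun α β => by
      rw [← (α.2 f).tsum_add (β.2 f)]
      refine ((α + β).2 f).tsum_le_tsum (fun t => ?_) ((α.2 f).add (β.2 f))
      rw [← add_mul]
      exact mul_le_mul_of_nonneg_right (norm_add_le _ _) (f.nonneg t))
    (fun c α => by
      rw [← tsum_mul_left]
      refine tsum_congr fun t => ?_
      rw [← mul_assoc, ← norm_mul]
      rfl)

/-- The topology of `O_b(G)`, generated by the seminorms `‖α‖_f`. -/
instance : TopologicalSpace (OFlat G) := (OFlat.seminorms G).moduleFilterBasis.topology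

theorem OFlat.withSeminorms : WithSeminorms (OFlat.seminorms G) := ⟨rfl⟩

instance : IsTopologicalAddGroup (OFlat G) := (OFlat.withSeminorms G).topologicalAddGroup

instance : ContinuousSMul ℂ (OFlat G) := (OFlat.withSeminorms G).continuousSMul

instance : LocallyConvexSpace ℝ (OFlat G) :=
  (OFlat.withSeminorms G).toLocallyConvexSpace

/-- The uniform structure of the topological group `O_b(G)`. -/
instance : UniformSpace (OFlat G) := IsTopologicalAddGroup.rightUniformSpace (OFlat G)

instance : IsUniformAddGroup (OFlat G) := isUniformAddGroup_of_addCommGroup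

/-- The dual space `O_b(G)^⋆`: all continuous linear functionals on `O_b(G)`, with
the topology of uniform convergence on totally bounded sets. -/
abbrev OFlatDual : Type _ :=
  UniformConvergenceCLM (E := OFlat G) (RingHom.id ℂ) ℂ {S : Set (OFlat G) | TotallyBounded S}

end Flat

end

open Filter Topology Set

/-! Point masses carry the duality: every `α` and every `u` is the unconditional sum of its values
times point masses, so continuous functionals on either side are determined by their values there. A
functional bounded by `C‖·‖_f` takes values at point masses dominated by `C f`; this gives the
bijection. Continuity of `u ↦ h_u`: on the rectangle of `f` all `h_u` are bounded by `‖·‖_f`, hence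
equicontinuous, so pointwise convergence is uniform on totally bounded sets; the universal property
of the injective limit does the rest. Continuity of the inverse is a bipolar argument. If `V` is an
open balanced convex neighbourhood of zero, Hahn–Banach and the description of the functionals on
`O_♯(G)` show that `|h_u| < 1` on the polar of `V` forces `u ∈ V`. The crux is that this polar is
totally bounded (`totallyBounded_polar`): `V` contains every element of the rectangle of `f` that
vanishes on a suitable finite set, which makes the `f`-weighted tails of the polar uniformly small.
-/

namespace Semicharacter

variable {G : Type*} [Group G]

/-- The multiple of a semicharacter by a real number `C ≥ 1` is a semicharacter. -/
def scale (f : Semicharacter G) (C : ℝ) (hC : 1 ≤ C) : Semicharacter G where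
  toFun t := C * f t
  one_le t := by nlinarith [f.one_le t]
  map_mul_le s t := by
    have h1 := f.map_mul_le s t
    have h2 := mul_nonneg (f.nonneg s) (f.nonneg t)
    calc C * f (s * t) ≤ C * (f s * f t) := mul_le_mul_of_nonneg_left h1 (by linarith)
      _ ≤ C * (C * (f s * f t)) :=
        le_mul_of_one_le_left (mul_nonneg (by linarith) h2) hC
      _ = C * f s * (C * f t) := by ring

end Semicharacter

theorem Finset.sum_smul_single_apply {ι : Type*} [DecidableEq ι] (T : Finset ι) (a : ι → ℂ)
    (s : ι) : ∑ t ∈ T, a t * (Pi.single t (1 : ℂ) : ι → ℂ) s = if s ∈ T then a s else 0 := by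
  simp [Pi.single_apply]

/-! ### Directed seminorms and point masses in `O_b(G)`. -/

namespace OFlat

variable {G : Type*} [Group G]

/-- The evaluation of the elements of `O_b(G)` at a point. -/
def eval (t : G) : OFlat G →ₗ[ℂ] ℂ where
  toFun α := α t
  map_add' _ _ := rfl
  map_smul' _ _ := rfl

theorem eval_apply (t : G) (α : OFlat G) : eval t α = α t := rfl

theorem add_apply (α β : OFlat G) (t : G) : (α + β) t = α t + β t := rfl

theorem sub_apply (α β : OFlat G) (t : G) : (α - β) t = α t - β t := rfl

theorem smul_apply (c : ℂ) (α : OFlat G) (t : G) : (c • α) t = c * α t := rfl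

theorem summable (α : OFlat G) (f : Semicharacter G) : Summable fun t => ‖α t‖ * f t := α.2 f

theorem seminorms_apply (f : Semicharacter G) (α : OFlat G) :
    seminorms G f α = ∑' t, ‖α t‖ * f t := rfl

open Classical in
/-- The characteristic function of a point, as an element of `O_b(G)`. -/
noncomputable def single (t : G) : OFlat G :=
  (⟨Pi.single t 1, fun f => summable_of_ne_finset_zero (s := {t}) fun s hs => by
    rw [Finset.mem_singleton] at hs
    simp [hs]⟩ : flatSubmodule G)

open Classical in
theorem single_apply (t s : G) : single t s = (Pi.single t (1 : ℂ) : G → ℂ) s := rfl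

open Classical in
theorem sum_smul_single_apply (T : Finset G) (a : G → ℂ) (s : G) :
    (∑ t ∈ T, a t • single t : OFlat G) s = if s ∈ T then a s else 0 := by
  rw [← eval_apply, map_sum, ← Finset.sum_smul_single_apply]
  rfl

theorem seminorms_single (f : Semicharacter G) (t : G) : seminorms G f (single t) = f t := by
  classical
  rw [seminorms_apply, tsum_eq_single t]
  · simp [single_apply]
  · intro s hs
    simp [single_apply, hs]

theorem seminorms_mono_add (f g : Semicharacter G) :
    seminorms G f ≤ seminorms G (f.add g) ∧ seminorms G g ≤ seminorms G (f.add g) := by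
  constructor <;> intro α <;>
    refine (α.summable _).tsum_le_tsum (fun t => ?_) (α.summable _) <;>
    refine mul_le_mul_of_nonneg_left ?_ (norm_nonneg _)
  · exact le_add_of_nonneg_right (g.nonneg t)
  · exact le_add_of_nonneg_left (f.nonneg t)

/-- Semicharacters are closed under sums, so the seminorms are directed and a single one suffices in
every neighbourhood or continuity estimate. -/
theorem exists_sup_seminorms_le (s : Finset (Semicharacter G)) :
    ∃ f : Semicharacter G, s.sup (seminorms G) ≤ seminorms G f := by
  classical
  induction s using Finset.induction_on with
  | empty => exact ⟨.one, bot_le⟩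
  | insert f s _ ih =>
    obtain ⟨g, hg⟩ := ih
    refine ⟨f.add g, ?_⟩
    rw [Finset.sup_insert]
    exact sup_le (seminorms_mono_add f g).1 (hg.trans (seminorms_mono_add f g).2)

theorem exists_seminorms_lt_of_mem_nhds_zero {U : Set (OFlat G)} (hU : U ∈ 𝓝 0) :
    ∃ f : Semicharacter G, ∃ r > 0, ∀ α, seminorms G f α < r → α ∈ U := by
  obtain ⟨s, r, hr, h⟩ := ((withSeminorms G).mem_nhds_iff 0 U).1 hU
  obtain ⟨f, hf⟩ := exists_sup_seminorms_le s
  refine ⟨f, r, hr, fun α hα => h ?_⟩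
  rw [Seminorm.mem_ball_zero]
  exact (hf α).trans_lt hα

theorem setOf_seminorms_lt_mem_nhds_zero (f : Semicharacter G) {r : ℝ} (hr : 0 < r) :
    {α | seminorms G f α < r} ∈ 𝓝 (0 : OFlat G) :=
  ((withSeminorms G).continuous_seminorm f).continuousAt.eventually_lt continuousAt_const
    (by simpa using hr)

theorem exists_norm_le (h : OFlat G →L[ℂ] ℂ) :
    ∃ f : Semicharacter G, ∃ C : ℝ, 0 < C ∧ ∀ α, ‖h α‖ ≤ C * seminorms G f α := by
  have hc : Continuous ((normSeminorm ℂ ℂ).comp h.toLinearMap) :=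
    continuous_norm.comp h.continuous
  obtain ⟨s, C, hC, hle⟩ := Seminorm.bound_of_continuous (withSeminorms G) _ hc
  obtain ⟨f, hf⟩ := exists_sup_seminorms_le s
  refine ⟨f, C, by positivity, fun α => (hle α).trans ?_⟩
  exact mul_le_mul_of_nonneg_left (hf α) C.2

theorem hasSum_smul_single (α : OFlat G) : HasSum (fun t => α t • single t) α := by
  classical
  refine ((withSeminorms G).tendsto_nhds _ _).2 fun f ε hε => ?_
  have h : HasSum (fun t => ‖α t‖ * f t) (∑' t, ‖α t‖ * f t) := (α.summable f).hasSum
  filter_upwards [Tendsto.eventually h (lt_mem_nhds (sub_lt_self _ hε))] with F hF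
  have h2 : HasSum (fun t => if t ∈ F then ‖α t‖ * f t else 0) (∑ t ∈ F, ‖α t‖ * f t) := by
    rw [← Finset.sum_congr rfl fun t ht => if_pos ht]
    exact hasSum_sum_of_ne_finset_zero fun t ht => if_neg ht
  -- The error of a partial sum is exactly the tail of the convergent series defining `‖α‖_f`.
  have h3 : seminorms G f (∑ t ∈ F, α t • single t - α)
      = ∑' t, ‖α t‖ * f t - ∑ t ∈ F, ‖α t‖ * f t := by
    rw [seminorms_apply, ← (h.sub h2).tsum_eq]
    refine tsum_congr fun t => ?_
    rw [sub_apply, sum_smul_single_apply]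
    by_cases ht : t ∈ F <;> simp [ht]
  rw [h3]
  linarith

end OFlat

/-! ### Rectangles in `O_♯(G)`, the pairing, and its bijectivity. -/

namespace OSharp

variable {G : Type*} [Group G]

@[ext]
theorem ext {u v : OSharp G} (h : ∀ t, u t = v t) : u = v :=
  Subtype.ext (funext h)

/-- The evaluation of the elements of `O_♯(G)` at a point. -/
def eval (t : G) : OSharp G →ₗ[ℂ] ℂ where
  toFun u := u t
  map_add' _ _ := rfl
  map_smul' _ _ := rfl

theorem eval_apply (t : G) (u : OSharp G) : eval t u = u t := rfl

theorem add_apply (u v : OSharp G) (t : G) : (u + v) t = u t + v t := rfl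

theorem sub_apply (u v : OSharp G) (t : G) : (u - v) t = u t - v t := rfl

theorem smul_apply (c : ℂ) (u : OSharp G) (t : G) : (c • u) t = c * u t := rfl

theorem exists_mem_rectangle (u : OSharp G) :
    ∃ f : Semicharacter G, ∀ t, ‖u t‖ ≤ f t := by
  obtain ⟨f, C, hC, h⟩ := u.2
  -- `C` may be below 1, and only factors at least 1 preserve semicharacters.
  refine ⟨f.scale (C + 1) (by linarith), fun t => (h t).trans ?_⟩
  exact mul_le_mul_of_nonneg_right (by linarith) (f.nonneg t)

/-- The inclusion into `O_♯(G)` of the rectangle generated by a semicharacter. -/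
def ofRectangle (f : Semicharacter G) (u : rectangle f) : OSharp G :=
  incl f (OSmith.dilation f 1 u)

theorem ofRectangle_apply (f : Semicharacter G) (u : rectangle f) (t : G) :
    ofRectangle f u t = u.1 t := one_mul (u.1 t)

theorem continuous_ofRectangle (f : Semicharacter G) : Continuous (ofRectangle f) :=
  (continuous_incl G f).comp (continuous_iSup_rng (i := 1) continuous_coinduced_rng)

open Classical in
/-- The characteristic function of a point, as an element of `O_♯(G)`. -/
noncomputable def single (t : G) : OSharp G :=
  (⟨Pi.single t 1, .one, 1, one_pos, fun s => by
    by_cases h : s = t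
    · subst h; simp [Semicharacter.one]
    · simp [h, Semicharacter.one]⟩ : sharpSubmodule G)

open Classical in
theorem single_apply (t s : G) : single t s = (Pi.single t (1 : ℂ) : G → ℂ) s := rfl

open Classical in
theorem sum_smul_single_apply (T : Finset G) (a : G → ℂ) (s : G) :
    (∑ t ∈ T, a t • single t : OSharp G) s = if s ∈ T then a s else 0 := by
  rw [← eval_apply, map_sum, ← Finset.sum_smul_single_apply]
  rfl

/-- The rectangle, with its pointwise topology, maps continuously into `O_♯(G)`, and a basic
pointwise neighbourhood of zero constrains only finitely many coordinates. -/
theorem exists_finset_forall_mem {V : Set (OSharp G)} (hV : V ∈ 𝓝 0) (f : Semicharacter G) :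
    ∃ T : Finset G, ∀ u : OSharp G, (∀ t, ‖u t‖ ≤ f t) → (∀ t ∈ T, u t = 0) → u ∈ V := by
  have h0 : (0 : G → ℂ) ∈ rectangle f := fun t => by simpa using f.nonneg t
  have hz : ofRectangle f ⟨0, h0⟩ = 0 := by
    ext t
    exact ofRectangle_apply f _ t
  have h := (continuous_ofRectangle f).continuousAt (x := ⟨0, h0⟩)
  rw [ContinuousAt, hz] at h
  have h1 := h hV
  rw [mem_map, nhds_subtype, mem_comap] at h1
  obtain ⟨W, hW, hWV⟩ := h1
  rw [nhds_pi, mem_pi'] at hW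
  obtain ⟨T, s, hs, hsW⟩ := hW
  refine ⟨T, fun u hu huT => ?_⟩
  have hmem : (⟨u.1, hu⟩ : rectangle f) ∈ ofRectangle f ⁻¹' V := by
    refine hWV (hsW fun t ht => ?_)
    show u t ∈ s t
    rw [huT t ht]
    exact mem_of_mem_nhds (hs t)
  have heq : ofRectangle f ⟨u.1, hu⟩ = u := by
    ext t
    exact ofRectangle_apply f _ t
  rwa [mem_preimage, heq] at hmem

theorem hasSum_smul_single (u : OSharp G) : HasSum (fun t => u t • single t) u := by
  classical
  obtain ⟨f, hf⟩ := u.exists_mem_rectangle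
  rw [HasSum, SummationFilter.unconditional_filter, ← tendsto_sub_nhds_zero_iff]
  intro V hV
  obtain ⟨T, hT⟩ := exists_finset_forall_mem hV f
  refine mem_map.2 ((eventually_ge_atTop T).mono fun F hF => ?_)
  refine hT _ (fun t => ?_) fun t ht => ?_
  · rw [sub_apply, sum_smul_single_apply]
    split_ifs
    · simpa using f.nonneg t
    · simpa using hf t
  · rw [sub_apply, sum_smul_single_apply, if_pos (hF ht), sub_self]

theorem norm_mul_apply_le {u : OSharp G} {f : Semicharacter G} (hu : ∀ t, ‖u t‖ ≤ f t)
    (α : OFlat G) (t : G) : ‖α t * u t‖ ≤ ‖α t‖ * f t := by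
  rw [norm_mul]
  exact mul_le_mul_of_nonneg_left (hu t) (norm_nonneg _)

theorem summable_mul (u : OSharp G) (α : OFlat G) : Summable fun t => α t * u t := by
  obtain ⟨f, hf⟩ := u.exists_mem_rectangle
  exact .of_norm_bounded (α.summable f) (norm_mul_apply_le hf α)

theorem norm_tsum_mul_le {u : OSharp G} {f : Semicharacter G} (hu : ∀ t, ‖u t‖ ≤ f t)
    (α : OFlat G) : ‖∑' t, α t * u t‖ ≤ OFlat.seminorms G f α :=
  tsum_of_norm_bounded (α.summable f).hasSum (norm_mul_apply_le hu α)

/-- The linear functional `α ↦ ∑ t, α t * u t` on `O_b(G)`. -/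
noncomputable def pairingLinear (u : OSharp G) : OFlat G →ₗ[ℂ] ℂ where
  toFun α := ∑' t, α t * u t
  map_add' α β := by
    rw [← (u.summable_mul α).tsum_add (u.summable_mul β)]
    exact tsum_congr fun t => by rw [OFlat.add_apply, add_mul]
  map_smul' c α := by
    rw [RingHom.id_apply, smul_eq_mul, ← tsum_mul_left]
    exact tsum_congr fun t => by rw [OFlat.smul_apply, mul_assoc]

/-- The continuous linear functional `α ↦ ∑ t, α t * u t` on `O_b(G)`. -/
noncomputable def pairing (u : OSharp G) : OFlat G →L[ℂ] ℂ where
  toLinearMap := u.pairingLinear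
  cont := by
    obtain ⟨f, hf⟩ := u.exists_mem_rectangle
    refine WithSeminorms.continuous_normedSpace_rng ℂ (OFlat.withSeminorms G) u.pairingLinear
      ⟨{f}, 1, fun α => ?_⟩
    rw [Finset.sup_singleton, one_smul]
    exact norm_tsum_mul_le hf α

theorem hasSum_pairing (u : OSharp G) (α : OFlat G) :
    HasSum (fun t => α t * u t) (u.pairing α) := (u.summable_mul α).hasSum

theorem norm_pairing_le {u : OSharp G} {f : Semicharacter G} (hu : ∀ t, ‖u t‖ ≤ f t)
    (α : OFlat G) : ‖u.pairing α‖ ≤ OFlat.seminorms G f α := norm_tsum_mul_le hu α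

theorem pairing_add (u v : OSharp G) (α : OFlat G) :
    (u + v).pairing α = u.pairing α + v.pairing α := by
  refine ((u + v).hasSum_pairing α).unique ?_
  have h := (u.hasSum_pairing α).add (v.hasSum_pairing α)
  rwa [show (fun t => α t * u t + α t * v t) = fun t => α t * (u + v) t from
    funext fun t => by rw [add_apply, mul_add]] at h

theorem pairing_smul (c : ℂ) (u : OSharp G) (α : OFlat G) :
    (c • u).pairing α = c * u.pairing α := by
  refine ((c • u).hasSum_pairing α).unique ?_
  have h := (u.hasSum_pairing α).mul_left c
  rwa [show (fun t => c * (α t * u t)) = fun t => α t * (c • u) t from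
    funext fun t => by rw [smul_apply]; ring] at h

theorem pairing_single_right (u : OSharp G) (t : G) : u.pairing (OFlat.single t) = u t := by
  classical
  refine (u.hasSum_pairing _).unique ?_
  convert hasSum_single t ?_ using 1
  · simp [OFlat.single_apply]
  · intro s hs
    simp [OFlat.single_apply, hs]

theorem pairing_single_left (t : G) (α : OFlat G) : (single t).pairing α = α t := by
  classical
  refine ((single t).hasSum_pairing _).unique ?_
  convert hasSum_single t ?_ using 1
  · simp [single_apply]
  · intro s hs
    simp [single_apply, hs]

variable (G) in
/-- The linear map `u ↦ h_u` from `O_♯(G)` to the dual of `O_b(G)`. -/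
noncomputable def toDual : OSharp G →ₗ[ℂ] OFlatDual G where
  toFun u := ContinuousLinearMap.toUniformConvergenceCLM (RingHom.id ℂ) ℂ _ u.pairing
  map_add' u v := UniformConvergenceCLM.ext _ _ (pairing_add u v)
  map_smul' c u := UniformConvergenceCLM.ext _ _ (pairing_smul c u)

theorem toDual_apply (u : OSharp G) (α : OFlat G) : toDual G u α = u.pairing α := rfl

theorem toDual_bijective : Function.Bijective (toDual G) := by
  constructor
  · intro u v h
    ext t
    rw [← pairing_single_right, ← pairing_single_right, ← toDual_apply, h, toDual_apply]
  · intro h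
    let h' : OFlat G →L[ℂ] ℂ :=
      (ContinuousLinearMap.toUniformConvergenceCLM (RingHom.id ℂ) ℂ _).symm h
    obtain ⟨f, C, hC, hle⟩ := OFlat.exists_norm_le h'
    let u : OSharp G := (⟨fun t => h' (OFlat.single t), f, C, hC, fun t => by
      rw [← OFlat.seminorms_single]
      exact hle _⟩ : sharpSubmodule G)
    refine ⟨u, UniformConvergenceCLM.ext _ _ fun α => ?_⟩
    refine (u.hasSum_pairing α).unique (?_ : HasSum _ (h' α))
    convert h'.hasSum (OFlat.hasSum_smul_single α) using 2 with t
    rw [map_smul, smul_eq_mul]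

/-! ### Continuity of `u ↦ h_u`. -/

theorem continuous_pairing_ofRectangle (f : Semicharacter G) (α : OFlat G) :
    Continuous fun u : rectangle f => (ofRectangle f u).pairing α := by
  refine continuous_tsum (u := fun t => ‖α t‖ * f t) (fun t => ?_) (α.summable f) fun t u => ?_
  · simp_rw [ofRectangle_apply]
    exact continuous_const.mul ((continuous_apply t).comp continuous_subtype_val)
  · refine norm_mul_apply_le (fun s => ?_) α t
    rw [ofRectangle_apply]
    exact u.2 s

theorem continuous_toDual_ofRectangle (f : Semicharacter G) :
    Continuous fun u : rectangle f => toDual G (ofRectangle f u) := by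
  have hrect (u : rectangle f) (α : OFlat G) :
      ‖(ofRectangle f u).pairing α‖ ≤ OFlat.seminorms G f α :=
    norm_pairing_le (fun t => by rw [ofRectangle_apply]; exact u.2 t) α
  refine continuous_iff_continuousAt.2 fun u₀ => ?_
  rw [ContinuousAt, UniformConvergenceCLM.tendsto_iff_tendstoUniformlyOn]
  intro S hS
  rw [Metric.tendstoUniformlyOn_iff]
  intro ε hε
  -- A finite `ε/3`-net for `‖·‖_f`: two thirds of `ε` go to the remainder `γ` under `u` and `u₀`,
  -- one third to the net point `β`.
  obtain ⟨F, hF, hSF⟩ := totallyBounded_iff_subset_finite_iUnion_nhds_zero.1 hS _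
    (OFlat.setOf_seminorms_lt_mem_nhds_zero f (show 0 < ε / 3 by positivity))
  have hev : ∀ᶠ u in 𝓝 u₀, ∀ β ∈ F,
      dist ((ofRectangle f u).pairing β) ((ofRectangle f u₀).pairing β) < ε / 3 :=
    (eventually_all_finite hF).2 fun β _ =>
      Metric.tendsto_nhds.1 (continuous_pairing_ofRectangle f β).continuousAt _ (by positivity)
  filter_upwards [hev] with u hu α hα
  obtain ⟨β, hβ, hαβ⟩ := mem_iUnion₂.1 (hSF hα)
  obtain ⟨γ, hγ, rfl⟩ := hαβ
  have h1 := (hrect u₀ γ).trans_lt hγ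
  have h2 := (hrect u γ).trans_lt hγ
  have h3 := hu β hβ
  rw [toDual_apply, toDual_apply]
  simp only [vadd_eq_add, map_add]
  rw [dist_eq_norm] at h3 ⊢
  calc _ = ‖(ofRectangle f u₀).pairing γ - (ofRectangle f u).pairing γ
        - ((ofRectangle f u).pairing β - (ofRectangle f u₀).pairing β)‖ := by congr 1; ring
    _ ≤ ‖(ofRectangle f u₀).pairing γ‖ + ‖(ofRectangle f u).pairing γ‖
        + ‖(ofRectangle f u).pairing β - (ofRectangle f u₀).pairing β‖ :=
      (norm_sub_le _ _).trans (add_le_add_left (norm_sub_le _ _) _)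
    _ < ε := by linarith

theorem directedOn_totallyBounded :
    DirectedOn (· ⊆ ·) {S : Set (OFlat G) | TotallyBounded S} := fun S hS T hT =>
  ⟨S ∪ T, TotallyBounded.union hS hT, subset_union_left, subset_union_right⟩

theorem continuous_toDual : Continuous (toDual G) := by
  have : ContinuousSMul ℂ (OFlatDual G) := UniformConvergenceCLM.continuousSMul _ _ _
    fun S hS => TotallyBounded.isVonNBounded ℂ hS
  have : LocallyConvexSpace ℝ (OFlatDual G) :=
    UniformConvergenceCLM.locallyConvexSpace ℝ _ ⟨∅, totallyBounded_empty⟩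
      directedOn_totallyBounded
  -- The topology pulled back from the dual is admissible, hence coarser than the injective limit
  -- topology.
  refine continuous_sInf_dom (t := .induced (toDual G) inferInstance) ⟨?_, ?_, ?_, fun f => ?_⟩
    continuous_induced_dom
  · exact topologicalAddGroup_induced (toDual G)
  · exact continuousSMul_induced (toDual G)
  · exact LocallyConvexSpace.induced ((toDual G).restrictScalars ℝ)
  · refine continuous_induced_rng.2 (continuous_iSup_dom.2 fun c => continuous_coinduced_dom.2 ?_)
    -- By linearity, continuity on the homothety by `c` reduces to the rectangle itself.
    have h (u : rectangle f) : c • toDual G (ofRectangle f u) =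
        toDual G (incl f (OSmith.dilation f c u)) := by
      rw [← map_smul]
      congr 1
      ext t
      rw [smul_apply, ofRectangle_apply]
      rfl
    exact ((continuous_toDual_ofRectangle f).const_smul c).congr h

end OSharp

/-! ### Polars of neighbourhoods, and continuity of the inverse. -/

theorem exists_isOpen_balanced_convex_subset {E : Type*} [AddCommGroup E] [Module ℂ E]
    [TopologicalSpace E] [IsTopologicalAddGroup E] [ContinuousSMul ℂ E] [LocallyConvexSpace ℝ E]
    {U : Set E} (hU : U ∈ 𝓝 0) :
    ∃ V : Set E, 0 ∈ V ∧ IsOpen V ∧ Balanced ℂ V ∧ Convex ℝ V ∧ V ⊆ U := by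
  have : ContinuousSMul ℝ E := IsScalarTower.continuousSMul ℂ
  obtain ⟨s, ⟨hs, hsc⟩, hsU⟩ := (LocallyConvexSpace.convex_basis_zero ℝ E).mem_iff.1 hU
  have h0 : 0 ∈ interior (convexHull ℝ (balancedCore ℂ s)) :=
    mem_interior_iff_mem_nhds.2
      (mem_of_superset (balancedCore_mem_nhds_zero hs) (subset_convexHull ℝ _))
  have hb : Balanced ℂ (convexHull ℝ (balancedCore ℂ s)) := fun c hc => by
    rw [← image_smul, show (fun x : E => c • x) = DistribSMul.toLinearMap ℝ E c from rfl,
      LinearMap.image_convexHull]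
    exact convexHull_mono (balancedCore_balanced s c hc)
  exact ⟨_, h0, isOpen_interior, hb.interior h0, (convex_convexHull ℝ _).interior,
    interior_subset.trans ((convexHull_min (balancedCore_subset s) hsc).trans hsU)⟩

namespace OSharp

variable {G : Type*} [Group G]

/-- The polar in `O_b(G)` of a subset of `O_♯(G)`. -/
def polar (V : Set (OSharp G)) : Set (OFlat G) :=
  {α | ∀ v ∈ V, ‖v.pairing α‖ ≤ 1}

/-- Test `φ` on the function supported on `F` with modulus at most `f` whose phases cancel those of
`φ (single t)`: it vanishes on `T`, so it lies in `V`, and `φ` of it is the sum to be bounded. -/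
theorem sum_norm_mul_le {V : Set (OSharp G)} {f : Semicharacter G} {T : Finset G}
    (hT : ∀ u : OSharp G, (∀ t, ‖u t‖ ≤ f t) → (∀ t ∈ T, u t = 0) → u ∈ V)
    {φ : OSharp G →ₗ[ℂ] ℂ} {r : ℝ} (hφ : ∀ v ∈ V, ‖φ v‖ ≤ r) {F : Finset G}
    (hF : Disjoint T F) : ∑ t ∈ F, ‖φ (single t)‖ * f t ≤ r := by
  classical
  let a : G → ℂ := fun t => (starRingEnd ℂ (φ (single t)) / ‖φ (single t)‖) * f t
  have ha (t : G) : ‖a t‖ ≤ f t := by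
    rw [norm_mul, norm_div, RCLike.norm_conj, Complex.norm_real, Complex.norm_real, norm_norm,
      Real.norm_of_nonneg (f.nonneg t)]
    -- Only an inequality: the phase is `0 / 0 = 0` where `φ (single t)` vanishes.
    exact mul_le_of_le_one_left (f.nonneg t) (div_self_le_one _)
  have hmem : ∑ t ∈ F, a t • single t ∈ V := by
    refine hT _ (fun t => ?_) fun t ht => ?_ <;> rw [sum_smul_single_apply]
    · split_ifs
      · exact ha t
      · simpa using f.nonneg t
    · rw [if_neg (Finset.disjoint_left.1 hF ht)]
  have hsum : φ (∑ t ∈ F, a t • single t) = ((∑ t ∈ F, ‖φ (single t)‖ * f t : ℝ) : ℂ) := by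
    rw [map_sum, Complex.ofReal_sum]
    refine Finset.sum_congr rfl fun t _ => ?_
    rw [map_smul, smul_eq_mul, Complex.ofReal_mul]
    by_cases h : φ (single t) = 0
    · simp [h]
    · have h1 : (‖φ (single t)‖ : ℂ) ≠ 0 := by simpa using h
      have h2 := Complex.conj_mul' (φ (single t))
      simp only [a]
      field_simp
      rw [mul_right_comm, h2]
  have h := hφ _ hmem
  rw [hsum, Complex.norm_real] at h
  exact (le_abs_self _).trans h

theorem exists_smul_single_mem {V : Set (OSharp G)} (hV : V ∈ 𝓝 0) (t : G) :
    ∃ c : ℂ, c ≠ 0 ∧ c • single t ∈ V := by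
  have h : Tendsto (fun c : ℂ => c • single t) (𝓝[≠] 0) (𝓝 (0 : OSharp G)) := by
    have : Continuous fun c : ℂ => c • single (G := G) t := continuous_id.smul continuous_const
    simpa using (this.tendsto 0).mono_left nhdsWithin_le_nhds
  obtain ⟨c, hc, hc0⟩ := ((h.eventually hV).and self_mem_nhdsWithin).exists
  exact ⟨c, hc0, hc⟩

/-- The functional `u ↦ h_u(α)` on `O_♯(G)`. -/
noncomputable def pairingLeft (α : OFlat G) : OSharp G →ₗ[ℂ] ℂ where
  toFun u := u.pairing α
  map_add' u v := pairing_add u v α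
  map_smul' c u := pairing_smul c u α

theorem norm_apply_le_of_mem_polar {V : Set (OSharp G)} {t : G} {c : ℂ} (hc : c ≠ 0)
    (hcV : c • single t ∈ V) {α : OFlat G} (hα : α ∈ polar V) : ‖α t‖ ≤ ‖c‖⁻¹ := by
  have h := hα _ hcV
  rw [pairing_smul, pairing_single_left, norm_mul] at h
  rwa [← one_div, le_div_iff₀' (norm_pos_iff.2 hc)]

theorem exists_finset_seminorms_sub_le {V : Set (OSharp G)} (hV : V ∈ 𝓝 0)
    (f : Semicharacter G) {r : ℝ} (hr : 0 < r) : ∃ T : Finset G, ∀ α ∈ polar V,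
      OFlat.seminorms G f (α - ∑ t ∈ T, α t • OFlat.single t) ≤ r := by
  classical
  have hr' : (r : ℂ) ≠ 0 := Complex.ofReal_ne_zero.2 hr.ne'
  -- Dilating `V` by `r` turns the polar bound 1 into the required `r`.
  have hV' : {v : OSharp G | (r : ℂ)⁻¹ • v ∈ V} ∈ 𝓝 0 :=
    (continuous_const_smul (r : ℂ)⁻¹).continuousAt (by rwa [smul_zero])
  obtain ⟨T, hT⟩ := exists_finset_forall_mem hV' f
  refine ⟨T, fun α hα => ?_⟩
  have hφ (v : OSharp G) (hv : (r : ℂ)⁻¹ • v ∈ V) : ‖pairingLeft α v‖ ≤ r := by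
    have h := hα _ hv
    rw [pairing_smul, norm_mul, norm_inv, Complex.norm_of_nonneg hr.le,
      inv_mul_le_iff₀ hr, mul_one] at h
    exact h
  refine Real.tsum_le_of_sum_le (fun t => mul_nonneg (norm_nonneg _) (f.nonneg t)) fun F => ?_
  have h := sum_norm_mul_le hT hφ (Finset.disjoint_sdiff (s := T) (t := F))
  refine le_trans (le_of_eq ?_) h
  rw [Finset.sdiff_eq_filter, Finset.sum_filter]
  refine Finset.sum_congr rfl fun t _ => ?_
  rw [OFlat.sub_apply, OFlat.sum_smul_single_apply]
  by_cases ht : t ∈ T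
  · simp [ht]
  · simp [ht, pairingLeft, pairing_single_left]

/-- Tails off a finite set `T` are uniformly small, while the heads lie in the continuous image of a
compact box, since `V` absorbs each point mass. -/
theorem totallyBounded_polar {V : Set (OSharp G)} (hV : V ∈ 𝓝 0) :
    TotallyBounded (polar V) := by
  classical
  rw [totallyBounded_iff_subset_finite_iUnion_nhds_zero]
  intro U hU
  obtain ⟨f, r, hr, hfU⟩ := OFlat.exists_seminorms_lt_of_mem_nhds_zero hU
  obtain ⟨T, hT⟩ := exists_finset_seminorms_sub_le hV f (half_pos hr)
  choose c hc hcV using exists_smul_single_mem hV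
  let B : Set (G → ℂ) := univ.pi fun t => Metric.closedBall 0 ‖c t‖⁻¹
  have hB : IsCompact B := isCompact_univ_pi fun t => isCompact_closedBall _ _
  have hcont : Continuous fun a : G → ℂ => ∑ t ∈ T, a t • OFlat.single t :=
    continuous_finsetSum _ fun t _ => (continuous_apply t).smul continuous_const
  obtain ⟨F, hF, hBF⟩ := totallyBounded_iff_subset_finite_iUnion_nhds_zero.1
    (hB.image hcont).totallyBounded _ (OFlat.setOf_seminorms_lt_mem_nhds_zero f (half_pos hr))
  refine ⟨F, hF, fun α hα => ?_⟩
  have hαB : α.1 ∈ B := fun t _ =>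
    mem_closedBall_zero_iff.2 (norm_apply_le_of_mem_polar (hc t) (hcV t) hα)
  obtain ⟨β, hβ, γ, hγ, hβγ⟩ := mem_iUnion₂.1 (hBF (mem_image_of_mem _ hαB))
  refine mem_iUnion₂.2 ⟨β, hβ, γ + (α - ∑ t ∈ T, α t • OFlat.single t), hfU _ ?_, ?_⟩
  · calc _ ≤ _ := map_add_le_add (OFlat.seminorms G f) _ _
      _ < r / 2 + r / 2 := add_lt_add_of_lt_of_le hγ (hT α hα)
      _ = r := add_halves r
  · simp only [vadd_eq_add] at hβγ ⊢
    rw [← add_assoc, hβγ]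
    exact add_sub_cancel _ _

theorem summable_norm_apply_single (φ : OSharp G →L[ℂ] ℂ) (f : Semicharacter G) :
    Summable fun t => ‖φ (single t)‖ * f t := by
  classical
  have hV : {v | ‖φ v‖ ≤ 1} ∈ 𝓝 (0 : OSharp G) := by
    have h : ∀ᶠ v in 𝓝 (0 : OSharp G), ‖φ v‖ < 1 :=
      φ.continuous.norm.continuousAt.eventually_lt continuousAt_const (by simp)
    exact h.mono fun v hv => hv.le
  obtain ⟨T, hT⟩ := exists_finset_forall_mem hV f
  have hnn (t : G) : 0 ≤ ‖φ (single t)‖ * f t := mul_nonneg (norm_nonneg _) (f.nonneg t)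
  refine summable_of_sum_le (c := ∑ t ∈ T, ‖φ (single t)‖ * f t + 1) hnn fun F => ?_
  calc ∑ t ∈ F, ‖φ (single t)‖ * f t ≤ ∑ t ∈ T ∪ F, ‖φ (single t)‖ * f t :=
        Finset.sum_le_sum_of_subset_of_nonneg Finset.subset_union_right fun t _ _ => hnn t
    _ = ∑ t ∈ T, ‖φ (single t)‖ * f t + ∑ t ∈ F \ T, ‖φ (single t)‖ * f t := by
      rw [← Finset.union_sdiff_self_eq_union, Finset.sum_union Finset.disjoint_sdiff]
    _ ≤ _ := add_le_add_right
      (sum_norm_mul_le (φ := φ.toLinearMap) hT (fun v hv => hv) Finset.disjoint_sdiff) _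

/-- Every continuous linear functional on `O_♯(G)` is given by an element of `O_b(G)`. -/
theorem exists_pairing_eq (φ : OSharp G →L[ℂ] ℂ) :
    ∃ α : OFlat G, ∀ u : OSharp G, u.pairing α = φ u := by
  let α : OFlat G :=
    (⟨fun t => φ (single t), fun f => summable_norm_apply_single φ f⟩ : flatSubmodule G)
  refine ⟨α, fun u => (u.hasSum_pairing α).unique ?_⟩
  convert φ.hasSum u.hasSum_smul_single using 2 with t
  rw [map_smul, smul_eq_mul, mul_comm]

theorem exists_mem_polar_one_le {V : Set (OSharp G)} (hVo : IsOpen V)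
    (hVb : Balanced ℂ V) (hVc : Convex ℝ V)
    (hV0 : (0 : OSharp G) ∈ V) {u : OSharp G} (hu : u ∉ V) :
    ∃ α ∈ polar V, 1 ≤ ‖u.pairing α‖ := by
  obtain ⟨φ, hφ⟩ := RCLike.geometric_hahn_banach_open_point (𝕜 := ℂ)
    hVc hVo hu
  have hs : 0 < (φ u).re := by simpa using hφ 0 hV0
  have hs' : 0 < ‖φ u‖ := hs.trans_le (Complex.re_le_norm _)
  obtain ⟨α, hα⟩ := exists_pairing_eq φ
  -- Hahn–Banach gives `Re φ v < Re φ u` on `V`; rotating `v` within the balanced set `V` upgrades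
  -- this to `‖φ v‖ < Re φ u`, whence the normalisation.
  refine ⟨((φ u).re : ℂ)⁻¹ • α, fun v hv => ?_, ?_⟩
  · rw [map_smul, norm_smul, hα, norm_inv, Complex.norm_of_nonneg hs.le,
      inv_mul_le_iff₀ hs, mul_one]
    by_cases h0 : φ v = 0
    · simpa [h0] using hs.le
    have hn : (‖φ v‖ : ℂ) ≠ 0 := by simpa using h0
    have hmem : (starRingEnd ℂ (φ v) / ‖φ v‖) • v ∈ V :=
      hVb.smul_mem (by
        rw [norm_div, RCLike.norm_conj, Complex.norm_real, norm_norm]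
        exact div_self_le_one _) hv
    have heq : φ ((starRingEnd ℂ (φ v) / ‖φ v‖) • v) = (‖φ v‖ : ℂ) := by
      rw [map_smul, smul_eq_mul, div_mul_eq_mul_div, Complex.conj_mul', sq, mul_div_assoc,
        div_self hn, mul_one]
    have h := hφ _ hmem
    rw [heq] at h
    simpa using h.le
  · rw [map_smul, norm_smul, hα, norm_inv, Complex.norm_of_nonneg hs.le, inv_mul_eq_div,
      one_le_div hs]
    exact Complex.re_le_norm _

variable (G) in
/-- The linear isomorphism `u ↦ h_u` from `O_♯(G)` onto the dual of `O_b(G)`. -/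
noncomputable def equivDual : OSharp G ≃ₗ[ℂ] OFlatDual G :=
  LinearEquiv.ofBijective (toDual G) toDual_bijective

theorem equivDual_apply (u : OSharp G) (α : OFlat G) : equivDual G u α = u.pairing α := rfl

theorem continuous_equivDual_symm : Continuous (equivDual G).symm := by
  refine continuous_of_continuousAt_zero (equivDual G).symm ?_
  rw [ContinuousAt, map_zero]
  intro U hU
  obtain ⟨V, hV0, hVo, hVb, hVc, hVU⟩ := exists_isOpen_balanced_convex_subset hU
  refine mem_map.2 ((UniformConvergenceCLM.eventually_nhds_zero_mapsTo (RingHom.id ℂ)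
    (show polar V ∈ {S : Set (OFlat G) | TotallyBounded S} from
      totallyBounded_polar (hVo.mem_nhds hV0)) (Metric.ball_mem_nhds 0 one_pos)).mono
    fun h hh => hVU ?_)
  by_contra hmem
  obtain ⟨α, hα, h1⟩ := exists_mem_polar_one_le hVo hVb hVc hV0 hmem
  have h2 := hh hα
  rw [← equivDual_apply, LinearEquiv.apply_symm_apply] at h1
  rw [mem_ball_zero_iff] at h2
  exact absurd h2 h1.not_gt

end OSharp

theorem theorem3p7 (G : Type*) [Group G] :
    ∃ Φ : OSharp G ≃L[ℂ] OFlatDual G,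
      ∀ (u : OSharp G) (α : OFlat G), HasSum (fun t : G => α t * u t) (Φ u α) :=
  ⟨{ OSharp.equivDual G with
      continuous_toFun := OSharp.continuous_toDual
      continuous_invFun := OSharp.continuous_equivDual_symm },
    fun u α => u.hasSum_pairing α⟩
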